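/- Let $S$ be a positively ordered commutative monoid (a commutative monoid with a partial order that is compatible with addition and has $0$ as least element). For $x,y\in S$ write $x\ll y$ if for every increasing sequence $(z_n)_n$ in $S$ that has a supremum with $y\le\sup_n z_n$ there is $n$ with $x\le z_n$. Recall that $S$ is a $\mathrm{Cu}$-semigroup if (O1) every increasing sequence has a supremum; (O2) every element is the supremum of a $\ll$-increasing sequence; (O3) $x'\ll x$ and $y'\ll y$ imply $x'+y'\ll x+y$; (O4) $\sup_n(x_n+y_n)=\sup_n x_n+\sup_n y_n$ for increasing sequences $(x_n)_n,(y_n)_n$. Consider the following properties of a $\mathrm{Cu}$-semigroup $S$: - (O5) If $s'\ll s$, $t'\ll t$ and $s+t\le x$, then there is $r$ with $t'\ll r$ and $s'+r\le x\le s+r$. - (O6) If $x'\ll x\le y+z$, then there are $e\le x,y$ and $f\le x,z$ with $x'\le e+f$. - (O7) If $x_1'\ll x_1\le y$ and $x_2'\ll x_2\le y$, then there is $x$ with $x_1',x_2'\ll x\le y$ and $x\le x_1+x_2$. - (O8) If $2e=e$, $x+y\ll z+e$, $x'\ll x$ and $y'\ll y$, then there are $z_1,z_2$ with $z_1+z_2\ll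 z$, $x'\ll z_1+e$, $y'\ll z_2+e$, $z_1\ll x+e$ and $z_2\ll y+e$. Let $S\otimes\{0,\infty\}$ be the tensor product of $\mathrm{Cu}$-semigroups, that is, the codomain of the universal $\mathrm{Cu}$-bimorphism on $S\times\{0,\infty\}$. A $\mathrm{Cu}$-semigroup is algebraic if every element is the supremum of an increasing sequence of elements $c$ with $c\ll c$. Let $S$ be a $\mathrm{Cu}$-semigroup satisfying (O5)–(O8) such that $S\otimes\{0,\infty\}$ is algebraic. Suppose that $S$ is weakly $(2,\omega)$-divisible: for all $x'\ll x$ in $S$ there are $n\in\mathbb N$ and $d_1,\dots,d_n\in S$ with $2d_1,\dots,2d_n\le x$ and $x'\le d_1+\dots+d_n$. Then $S$ is $(2,\omega)$-divisible: for all $x'\ll x$ in $S$ there are $n\in\mathbb N$ and $d\in S$ with $2d\le x$ and $x'\le nd$. -/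

import Mathlib

universe u v w

namespace Cuntz

/-- The (sequential) way-below relation: `x ≪ y` if every increasing sequence whose supremum
exists and dominates `y` has a term dominating `x`. (In a Cu-semigroup all such suprema exist.) -/
def WayBelow {S : Type u} [PartialOrder S] (x y : S) : Prop :=
  ∀ z : ℕ → S, Monotone z → ∀ s : S, IsLUB (Set.range z) s → y ≤ s → ∃ n, x ≤ z n

infix:50 " ≪ " => WayBelow

/-- A Cu-semigroup: a positively ordered commutative monoid that satisfies (O1)-(O4). -/
class IsCuSemigroup (S : Type u) [AddCommMonoid S] [PartialOrder S] : Prop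
    extends IsOrderedAddMonoid S where
  /-- the order is positive -/
  zero_le' : ∀ x : S, 0 ≤ x
  /-- (O1) increasing sequences have suprema -/
  exists_sup : ∀ z : ℕ → S, Monotone z → ∃ s, IsLUB (Set.range z) s
  /-- (O2) every element is the supremum of a `≪`-increasing sequence -/
  exists_seq : ∀ x : S, ∃ z : ℕ → S, (∀ n, z n ≪ z (n + 1)) ∧ IsLUB (Set.range z) x
  /-- (O3) addition is compatible with `≪` -/
  add_wayBelow : ∀ x' x y' y : S, x' ≪ x → y' ≪ y → x' + y' ≪ x + y
  /-- (O4) addition is compatible with suprema of increasing sequences -/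
  add_sup : ∀ a b : ℕ → S, Monotone a → Monotone b → ∀ s t : S,
    IsLUB (Set.range a) s → IsLUB (Set.range b) t →
      IsLUB (Set.range fun n => a n + b n) (s + t)

section Properties

variable (S : Type u) [AddCommMonoid S] [PartialOrder S]

/-- (O5), almost algebraic order. -/
def O5 : Prop :=
  ∀ s' s t' t x : S, s' ≪ s → t' ≪ t → s + t ≤ x →
    ∃ r : S, t' ≪ r ∧ s' + r ≤ x ∧ x ≤ s + r

/-- (O6), almost Riesz decomposition. -/
def O6 : Prop :=
  ∀ x' x y z : S, x' ≪ x → x ≤ y + z →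
    ∃ e f : S, e ≤ x ∧ e ≤ y ∧ f ≤ x ∧ f ≤ z ∧ x' ≤ e + f

/-- (O7), almost bounded sup-semilattice condition. -/
def O7 : Prop :=
  ∀ x₁' x₁ x₂' x₂ y : S, x₁' ≪ x₁ → x₁ ≤ y → x₂' ≪ x₂ → x₂ ≤ y →
    ∃ x : S, x₁' ≪ x ∧ x₂' ≪ x ∧ x ≤ y ∧ x ≤ x₁ + x₂

/-- (O8), almost lifting of orthogonal elements modulo an ideal (with largest element `e`). -/
def O8 : Prop :=
  ∀ x' x y' y z e : S, e + e = e → x + y ≪ z + e → x' ≪ x → y' ≪ y →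
    ∃ z₁ z₂ : S, z₁ + z₂ ≪ z ∧ x' ≪ z₁ + e ∧ y' ≪ z₂ + e ∧ z₁ ≪ x + e ∧ z₂ ≪ y + e

/-- Weak `(2,ω)`-divisibility. -/
def WeaklyTwoOmegaDivisible : Prop :=
  ∀ x' x : S, x' ≪ x →
    ∃ (n : ℕ) (d : Fin n → S), (∀ i, 2 • d i ≤ x) ∧ x' ≤ ∑ i, d i

/-- `(2,ω)`-divisibility. -/
def TwoOmegaDivisible : Prop :=
  ∀ x' x : S, x' ≪ x → ∃ (n : ℕ) (d : S), 2 • d ≤ x ∧ x' ≤ n • d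

end Properties

/-- A Cu-semigroup is algebraic if every element is the supremum of an increasing sequence of
compact elements, that is, of elements `c` with `c ≪ c`. -/
def IsAlgebraic (S : Type u) [PartialOrder S] : Prop :=
  ∀ x : S, ∃ c : ℕ → S, Monotone c ∧ (∀ n, c n ≪ c n) ∧ IsLUB (Set.range c) x

/-- Cu-morphisms: ordered monoid maps that preserve suprema of increasing sequences and `≪`. -/
structure IsCuMorphism {S : Type u} {T : Type v} [AddCommMonoid S] [PartialOrder S]
    [AddCommMonoid T] [PartialOrder T] (f : S → T) : Prop where
  map_zero : f 0 = 0
  map_add : ∀ x y, f (x + y) = f x + f y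
  mono : Monotone f
  map_sup : ∀ a : ℕ → S, Monotone a → ∀ s, IsLUB (Set.range a) s →
    IsLUB (Set.range fun n => f (a n)) (f s)
  map_wayBelow : ∀ x' x, x' ≪ x → f x' ≪ f x

/-- Cu-bimorphisms: in each variable, ordered monoid maps that preserve suprema of increasing
sequences; jointly, `≪` is preserved. -/
structure IsCuBimorphism {S : Type u} {T : Type v} {R : Type w} [AddCommMonoid S] [PartialOrder S]
    [AddCommMonoid T] [PartialOrder T] [AddCommMonoid R] [PartialOrder R]
    (f : S → T → R) : Prop where
  zero_left : ∀ t, f 0 t = 0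
  zero_right : ∀ s, f s 0 = 0
  add_left : ∀ s₁ s₂ t, f (s₁ + s₂) t = f s₁ t + f s₂ t
  add_right : ∀ s t₁ t₂, f s (t₁ + t₂) = f s t₁ + f s t₂
  mono_left : ∀ t, Monotone fun s => f s t
  mono_right : ∀ s, Monotone (f s)
  sup_left : ∀ a : ℕ → S, Monotone a → ∀ s, IsLUB (Set.range a) s → ∀ t,
    IsLUB (Set.range fun n => f (a n) t) (f s t)
  sup_right : ∀ b : ℕ → T, Monotone b → ∀ t, IsLUB (Set.range b) t → ∀ s,
    IsLUB (Set.range fun n => f s (b n)) (f s t)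
  map_wayBelow : ∀ s' s t' t, s' ≪ s → t' ≪ t → f s' t' ≪ f s t

/-- The Cu-semigroup `P` together with `ω : S × T → P` is the tensor product `S ⊗ T` in the
category of Cu-semigroups: `ω` is the universal Cu-bimorphism on `S × T`. -/
structure IsCuTensorProduct {S : Type u} {T : Type v} {P : Type (max u v)}
    [AddCommMonoid S] [PartialOrder S] [AddCommMonoid T] [PartialOrder T]
    [AddCommMonoid P] [PartialOrder P] (ω : S → T → P) : Prop where
  bimorphism : IsCuBimorphism ω
  universal : ∀ (R : Type (max u v)) [AddCommMonoid R] [PartialOrder R] [IsCuSemigroup R]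
    (φ : S → T → R), IsCuBimorphism φ →
      ∃! α : P → R, IsCuMorphism α ∧ ∀ s t, α (ω s t) = φ s t

/-- The Cu-semigroup `{0,∞}`, as an ordered submonoid of `{0,1,2,...,∞}`. -/
def zeroInfty : AddSubmonoid ℕ∞ where
  carrier := {0, ⊤}
  zero_mem' := by simp
  add_mem' := by
    rintro a b (rfl | rfl) (rfl | rfl) <;> simp

/-! `{0,∞}` is a Cu-semigroup, and the tensor product `S ⊗ {0,∞}` exists for every
Cu-semigroup `S`. -/

namespace zeroInfty

/-- The element `∞` of `{0,∞}`. -/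
def infty : zeroInfty := ⟨⊤, by right; rfl⟩

theorem eq_or (t : zeroInfty) : t = 0 ∨ t = infty := by
  obtain ⟨t, rfl | rfl⟩ := t
  · exact Or.inl rfl
  · exact Or.inr rfl

theorem infty_ne_zero : infty ≠ 0 := by
  intro h
  have := congrArg Subtype.val h
  simp [infty] at this

theorem le_infty (t : zeroInfty) : t ≤ infty := by
  change t.1 ≤ ⊤
  exact le_top

theorem zero_le_elt (t : zeroInfty) : 0 ≤ t := by
  change (0 : ℕ∞) ≤ t.1
  simp

theorem add_self (t : zeroInfty) : t + t = t := by
  obtain rfl | rfl := eq_or t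
  · simp
  · exact Subtype.ext (by simp [infty])

/-- Suprema of sequences in `{0,∞}` are attained. -/
theorem exists_eq_of_isLUB {z : ℕ → zeroInfty} {s : zeroInfty} (h : IsLUB (Set.range z) s) :
    ∃ n, z n = s := by
  by_contra! hn
  obtain rfl | rfl := eq_or s
  · exact hn 0 (le_antisymm (h.1 ⟨0, rfl⟩) (zero_le_elt _))
  · have h0 : ∀ n, z n = 0 := fun n => (eq_or (z n)).resolve_right (hn n)
    refine infty_ne_zero (le_antisymm (h.2 ?_) (zero_le_elt _))
    rintro _ ⟨n, rfl⟩
    exact (h0 n).le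

theorem wayBelow_of_le {x y : zeroInfty} (h : x ≤ y) : x ≪ y := by
  intro z _ s hs hy
  obtain ⟨n, rfl⟩ := exists_eq_of_isLUB hs
  exact ⟨n, h.trans hy⟩

theorem le_of_wayBelow {x y : zeroInfty} (h : x ≪ y) : x ≤ y := by
  obtain ⟨n, hn⟩ := h (fun _ => y) monotone_const y (by simp) le_rfl
  exact hn

instance : IsCuSemigroup zeroInfty where
  zero_le' := zero_le_elt
  exists_sup z _ := by
    by_cases h : ∃ n, z n = infty
    · obtain ⟨n, hn⟩ := h
      refine ⟨infty, ?_, fun u hu => hn ▸ hu ⟨n, rfl⟩⟩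
      rintro _ ⟨m, rfl⟩
      exact le_infty _
    · push Not at h
      refine ⟨0, ?_, fun u _ => zero_le_elt u⟩
      rintro _ ⟨m, rfl⟩
      exact ((eq_or (z m)).resolve_right (h m)).le
  exists_seq x := ⟨fun _ => x, fun _ => wayBelow_of_le le_rfl, by simp⟩
  add_wayBelow x' x y' y hx hy :=
    wayBelow_of_le (add_le_add (le_of_wayBelow hx) (le_of_wayBelow hy))
  add_sup a b ha hb s t hs ht := by
    refine ⟨?_, fun u hu => ?_⟩
    · rintro _ ⟨n, rfl⟩
      exact add_le_add (hs.1 ⟨n, rfl⟩) (ht.1 ⟨n, rfl⟩)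
    · obtain ⟨n, rfl⟩ := exists_eq_of_isLUB hs
      obtain ⟨m, rfl⟩ := exists_eq_of_isLUB ht
      exact (add_le_add (ha (le_max_left n m)) (hb (le_max_right n m))).trans
        (hu ⟨max n m, rfl⟩)

end zeroInfty

theorem WayBelow.le {S : Type u} [PartialOrder S] {x y : S} (h : x ≪ y) : x ≤ y := by
  obtain ⟨n, hn⟩ := h (fun _ => y) monotone_const y (by simp) le_rfl
  exact hn

theorem WayBelow.trans_le {S : Type u} [PartialOrder S] {x y z : S} (h : x ≪ y) (h' : y ≤ z) : x ≪ z :=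
  fun a ha s hs hz => h a ha s hs (h'.trans hz)

theorem WayBelow.le_trans {S : Type u} [PartialOrder S] {x y z : S} (h : x ≤ y) (h' : y ≪ z) : x ≪ z := fun a ha s hs hz =>
  (h' a ha s hs hz).imp fun _ hn => h.trans hn

section Existence

variable {S : Type u} [AddCommMonoid S] [PartialOrder S]

variable [IsCuSemigroup S]

theorem nsmul_mono (x : S) : Monotone fun n : ℕ => n • x := fun _ _ h =>
  nsmul_le_nsmul_left (IsCuSemigroup.zero_le' x) h

/-- The element `∞x`, the supremum of the multiples of `x`. -/
noncomputable def inftyMul (x : S) : S :=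
  (IsCuSemigroup.exists_sup (fun n : ℕ => n • x) (nsmul_mono x)).choose

theorem isLUB_inftyMul (x : S) : IsLUB (Set.range fun n : ℕ => n • x) (inftyMul x) :=
  (IsCuSemigroup.exists_sup (fun n : ℕ => n • x) (nsmul_mono x)).choose_spec

theorem le_inftyMul (x : S) : x ≤ inftyMul x :=
  (isLUB_inftyMul x).1 ⟨1, one_nsmul x⟩

theorem le_add_right' (x y : S) : x ≤ x + y := le_add_of_nonneg_right (IsCuSemigroup.zero_le' y)

theorem le_add_left' (x y : S) : y ≤ x + y := le_add_of_nonneg_left (IsCuSemigroup.zero_le' x)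

theorem inftyMul_add_self (x : S) : inftyMul x + inftyMul x = inftyMul x := by
  refine le_antisymm ?_ (le_add_right' _ _)
  refine (IsCuSemigroup.add_sup _ _ (nsmul_mono x) (nsmul_mono x) _ _
    (isLUB_inftyMul x) (isLUB_inftyMul x)).2 ?_
  rintro _ ⟨n, rfl⟩
  exact (isLUB_inftyMul x).1 ⟨n + n, add_nsmul x n n⟩

theorem inftyMul_le {x e : S} (he : e + e = e) (h : x ≤ e) : inftyMul x ≤ e := by
  refine (isLUB_inftyMul x).2 ?_
  rintro _ ⟨n, rfl⟩
  induction n with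
  | zero => simpa using IsCuSemigroup.zero_le' e
  | succ n ih =>
    change (n + 1) • x ≤ e
    rw [succ_nsmul, ← he]
    exact add_le_add ih h

variable (S) in
/-- The submonoid of idempotent elements; it is a model for `S ⊗ {0,∞}`. -/
def idem : AddSubmonoid S where
  carrier := {e | e + e = e}
  zero_mem' := add_zero 0
  add_mem' := by
    intro a b ha hb
    change a + b + (a + b) = a + b
    rw [add_add_add_comm, ha, hb]

theorem idem_add_le {a b e : idem S} (ha : a ≤ e) (hb : b ≤ e) : a + b ≤ e := by
  change a.1 + b.1 ≤ e.1
  rw [← e.2]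
  exact add_le_add ha hb

/-- The element `∞x` among the idempotents. -/
noncomputable def toIdem (x : S) : idem S := ⟨inftyMul x, inftyMul_add_self x⟩

theorem toIdem_le {x : S} {e : idem S} : toIdem x ≤ e ↔ x ≤ e.1 :=
  ⟨fun h => (le_inftyMul x).trans h, fun h => inftyMul_le e.2 h⟩

theorem toIdem_coe (e : idem S) : toIdem e.1 = e :=
  le_antisymm (toIdem_le.2 le_rfl) (le_inftyMul e.1)

theorem toIdem_mono : Monotone (toIdem : S → idem S) := fun _ y h =>
  toIdem_le.2 (h.trans (le_inftyMul y))

theorem toIdem_zero : toIdem (0 : S) = 0 := toIdem_coe 0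

theorem toIdem_add (x y : S) : toIdem (x + y) = toIdem x + toIdem y :=
  le_antisymm (toIdem_le.2 (add_le_add (le_inftyMul x) (le_inftyMul y)))
    (idem_add_le (toIdem_mono (le_add_right' x y)) (toIdem_mono (le_add_left' x y)))

theorem toIdem_sup {a : ℕ → S} {s : S} (hs : IsLUB (Set.range a) s) :
    IsLUB (Set.range fun n => toIdem (a n)) (toIdem s) := by
  refine ⟨?_, fun e he => toIdem_le.2 (hs.2 ?_)⟩
  · rintro _ ⟨n, rfl⟩
    exact toIdem_mono (hs.1 ⟨n, rfl⟩)
  · rintro _ ⟨n, rfl⟩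
    exact toIdem_le.1 (he ⟨n, rfl⟩)

theorem idem_isLUB {z : ℕ → idem S} (hz : Monotone z) {s : S}
    (hs : IsLUB (Set.range fun n => (z n).1) s) :
    ∃ h : s + s = s, IsLUB (Set.range z) (⟨s, h⟩ : idem S) := by
  have hm : Monotone fun n => (z n).1 := fun _ _ h => hz h
  have h2 : s + s = s := by
    refine le_antisymm ((IsCuSemigroup.add_sup _ _ hm hm _ _ hs hs).2 ?_) (le_add_right' _ _)
    rintro _ ⟨n, rfl⟩
    change (z n).1 + (z n).1 ≤ s
    rw [(z n).2]
    exact hs.1 ⟨n, rfl⟩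
  refine ⟨h2, ?_, fun e he => hs.2 ?_⟩
  · rintro _ ⟨n, rfl⟩
    exact hs.1 ⟨n, rfl⟩
  · rintro _ ⟨n, rfl⟩
    exact he ⟨n, rfl⟩

theorem isLUB_coe {z : ℕ → idem S} (hz : Monotone z) {e : idem S} (he : IsLUB (Set.range z) e) :
    IsLUB (Set.range fun n => (z n).1) e.1 := by
  obtain ⟨s, hs⟩ := IsCuSemigroup.exists_sup (fun n => (z n).1) (fun _ _ h => hz h)
  obtain ⟨h, hs'⟩ := idem_isLUB hz hs
  rw [he.unique hs']
  exact hs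

theorem toIdem_wayBelow {x y : S} (h : x ≪ y) : toIdem x ≪ toIdem y := by
  intro z hz e he hy
  obtain ⟨n, hn⟩ := h _ (fun _ _ h => hz h) _ (isLUB_coe hz he) (toIdem_le.1 hy)
  exact ⟨n, toIdem_le.2 hn⟩

instance : IsCuSemigroup (idem S) where
  zero_le' x := IsCuSemigroup.zero_le' x.1
  exists_sup z hz := by
    obtain ⟨s, hs⟩ := IsCuSemigroup.exists_sup (fun n => (z n).1) (fun _ _ h => hz h)
    obtain ⟨h, hs'⟩ := idem_isLUB hz hs
    exact ⟨_, hs'⟩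
  exists_seq e := by
    obtain ⟨z, hz, hs⟩ := IsCuSemigroup.exists_seq e.1
    exact ⟨fun n => toIdem (z n), fun n => toIdem_wayBelow (hz n), toIdem_coe e ▸ toIdem_sup hs⟩
  add_wayBelow x' x y' y hx hy := by
    intro z hz e he h
    obtain ⟨n, hn⟩ := hx z hz e he ((le_add_right' x.1 y.1).trans h)
    obtain ⟨m, hm⟩ := hy z hz e he ((le_add_left' x.1 y.1).trans h)
    exact ⟨max n m, idem_add_le (hn.trans (hz (le_max_left n m)))
      (hm.trans (hz (le_max_right n m)))⟩
  add_sup a b ha hb s t hs ht := by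
    refine ⟨?_, fun e he => idem_add_le (hs.2 ?_) (ht.2 ?_)⟩
    · rintro _ ⟨n, rfl⟩
      exact add_le_add (hs.1 ⟨n, rfl⟩) (ht.1 ⟨n, rfl⟩)
    · rintro _ ⟨n, rfl⟩
      exact (le_add_right' (a n).1 (b n).1).trans (he ⟨n, rfl⟩)
    · rintro _ ⟨n, rfl⟩
      exact (le_add_left' (a n).1 (b n).1).trans (he ⟨n, rfl⟩)

open Classical in
/-- The map `(x, 0) ↦ 0`, `(x, ∞) ↦ ∞x`. -/
noncomputable def toIdemPair (x : S) (t : zeroInfty) : idem S := if t = 0 then 0 else toIdem x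

theorem toIdemPair_zero (x : S) : toIdemPair x 0 = 0 := if_pos rfl

theorem toIdemPair_infty (x : S) : toIdemPair x zeroInfty.infty = toIdem x :=
  if_neg zeroInfty.infty_ne_zero

theorem toIdemPair_bimorphism : IsCuBimorphism (toIdemPair : S → zeroInfty → idem S) where
  zero_left t := by
    obtain rfl | rfl := zeroInfty.eq_or t
    · exact toIdemPair_zero _
    · rw [toIdemPair_infty, toIdem_zero]
  zero_right := toIdemPair_zero
  add_left x y t := by
    obtain rfl | rfl := zeroInfty.eq_or t
    · simp [toIdemPair_zero]
    · simp only [toIdemPair_infty, toIdem_add]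
  add_right x t₁ t₂ := by
    obtain rfl | rfl := zeroInfty.eq_or t₁
    · simp [toIdemPair_zero]
    · obtain rfl | rfl := zeroInfty.eq_or t₂
      · simp [toIdemPair_zero]
      · rw [zeroInfty.add_self, toIdemPair_infty]
        exact Subtype.ext (toIdem x).2.symm
  mono_left t := by
    obtain rfl | rfl := zeroInfty.eq_or t
    · intro x y _
      simp [toIdemPair_zero]
    · simpa only [toIdemPair_infty] using toIdem_mono
  mono_right x t₁ t₂ h := by
    obtain rfl | rfl := zeroInfty.eq_or t₁
    · rw [toIdemPair_zero]
      exact IsCuSemigroup.zero_le' _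
    · rw [le_antisymm h (zeroInfty.le_infty t₂)]
  sup_left a ha s hs t := by
    obtain rfl | rfl := zeroInfty.eq_or t
    · simp [toIdemPair_zero]
    · simpa only [toIdemPair_infty] using toIdem_sup hs
  sup_right b hb t ht x := by
    obtain ⟨n, rfl⟩ := zeroInfty.exists_eq_of_isLUB ht
    have key : ∀ m, toIdemPair x (b m) ≤ toIdemPair x (b n) := fun m => by
      obtain h | h := zeroInfty.eq_or (b m)
      · rw [h, toIdemPair_zero]
        exact IsCuSemigroup.zero_le' _
      · have h1 : b m ≤ b n := ht.1 ⟨m, rfl⟩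
        rw [le_antisymm h1 (h ▸ zeroInfty.le_infty _)]
    refine ⟨?_, fun e he => he ⟨n, rfl⟩⟩
    rintro _ ⟨m, rfl⟩
    exact key m
  map_wayBelow x' x t' t hx ht := by
    obtain rfl | rfl := zeroInfty.eq_or t'
    · rw [toIdemPair_zero]
      exact fun z _ e _ _ => ⟨0, IsCuSemigroup.zero_le' _⟩
    · rw [← le_antisymm (zeroInfty.le_of_wayBelow ht) (zeroInfty.le_infty t)]
      simpa only [toIdemPair_infty] using toIdem_wayBelow hx

theorem IsCuBimorphism.map_inftyMul {R : Type w} [AddCommMonoid R] [PartialOrder R]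
    {φ : S → zeroInfty → R} (hφ : IsCuBimorphism φ) (x : S) :
    φ (inftyMul x) zeroInfty.infty = φ x zeroInfty.infty := by
  refine le_antisymm ((hφ.sup_left _ (nsmul_mono x) _ (isLUB_inftyMul x) _).2 ?_)
    (hφ.mono_left _ (le_inftyMul x))
  rintro _ ⟨n, rfl⟩
  change φ (n • x) _ ≤ _
  have h2 : φ x zeroInfty.infty + φ x zeroInfty.infty = φ x zeroInfty.infty := by
    rw [← hφ.add_right, zeroInfty.add_self]
  have h3 : ∀ n : ℕ, φ ((n + 1) • x) zeroInfty.infty = φ x zeroInfty.infty := by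
    intro n
    induction n with
    | zero => simp
    | succ n ih => rw [succ_nsmul, hφ.add_left, ih, h2]
  rw [← h3 n]
  exact hφ.mono_left _ (nsmul_mono x n.le_succ)

variable (S) in
/-- For every Cu-semigroup `S`, the tensor product `S ⊗ {0,∞}` exists. -/
theorem exists_tensor_zeroInfty :
    ∃ (P : Type u) (_ : AddCommMonoid P) (_ : PartialOrder P) (_ : IsCuSemigroup P)
      (ω : S → zeroInfty → P), IsCuTensorProduct ω := by
  refine ⟨idem S, inferInstance, inferInstance, inferInstance, toIdemPair,
    toIdemPair_bimorphism, ?_⟩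
  intro R _ _ _ φ hφ
  refine ⟨fun e => φ e.1 zeroInfty.infty, ⟨⟨?_, ?_, ?_, ?_, ?_⟩, ?_⟩, ?_⟩
  · exact hφ.zero_left _
  · exact fun x y => hφ.add_left _ _ _
  · exact fun x y h => hφ.mono_left _ h
  · exact fun a ha s hs => hφ.sup_left _ (fun _ _ h => ha h) _ (isLUB_coe ha hs) _
  · intro e' e h
    obtain ⟨z, hz, hs⟩ := IsCuSemigroup.exists_seq e.1
    obtain ⟨n, hn⟩ := h (fun n => toIdem (z n))
      (toIdem_mono.comp (monotone_nat_of_le_succ fun n => (hz n).le)) _ (toIdem_sup hs)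
      (toIdem_coe e).ge
    refine WayBelow.le_trans (y := φ (z n) zeroInfty.infty) ?_ ?_
    · rw [← hφ.map_inftyMul (z n)]
      exact hφ.mono_left _ hn
    · exact (hφ.map_wayBelow _ _ _ _ (hz n) (zeroInfty.wayBelow_of_le le_rfl)).trans_le
        (hφ.mono_left _ (hs.1 ⟨n + 1, rfl⟩))
  · intro x t
    obtain rfl | rfl := zeroInfty.eq_or t
    · rw [toIdemPair_zero, hφ.zero_right]
      exact hφ.zero_left _
    · rw [toIdemPair_infty]
      exact hφ.map_inftyMul x
  · rintro β ⟨_, hβ⟩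
    funext e
    rw [← hβ, toIdemPair_infty, toIdem_coe]

end Existence

end Cuntz

namespace Cuntz

/-! ### Interpolation and compact approximation. -/

section Approximation

variable {S : Type u} [AddCommMonoid S] [PartialOrder S] [IsCuSemigroup S]

/-! Idempotents of `S` play the role of ideals, `toIdem x` being the ideal generated by `x`;
algebraicity of the tensor product passes to `idem S`. If `x' ≪ x`, some compact ideal `c` lies
between those of `x'` and `x`, and it suffices to find `d` with `2 • d ≤ x` and `c ≤ toIdem d`: then
`x' ≪ inftyMul d`, so `x'` is below a multiple of `d`.

Weak divisibility supplies finitely many divisors that jointly generate `c`. They are cut down to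
compact ideals (`exists_le_toIdem_eq`) and merged two at a time (`exists_common_divisor`): the
second divisor is lifted into an almost complement of the first, and whatever part of the first its
ideal misses is added. -/

theorem zero_wayBelow (x : S) : (0 : S) ≪ x :=
  fun _ _ _ _ _ => ⟨0, IsCuSemigroup.zero_le' _⟩

theorem exists_wayBelow_between {k x : S} (h : k ≪ x) : ∃ m, k ≪ m ∧ m ≪ x := by
  obtain ⟨z, hz, hs⟩ := IsCuSemigroup.exists_seq x
  obtain ⟨n, hn⟩ := h z (monotone_nat_of_le_succ fun n => (hz n).le) x hs le_rfl
  exact ⟨z (n + 1), (hz n).le_trans hn, (hz (n + 1)).trans_le (hs.1 ⟨n + 2, rfl⟩)⟩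

theorem exists_wayBelow_le_add {k x e : S} (h : k ≪ x + e) : ∃ x', x' ≪ x ∧ k ≤ x' + e := by
  obtain ⟨z, hz, hs⟩ := IsCuSemigroup.exists_seq x
  have hm : Monotone z := monotone_nat_of_le_succ fun n => (hz n).le
  obtain ⟨n, hn⟩ := h (fun n => z n + e) (fun _ _ h => add_le_add_left (hm h) e) _
    (IsCuSemigroup.add_sup z (fun _ => e) hm monotone_const x e hs (by simp)) le_rfl
  exact ⟨z n, (hz n).trans_le (hs.1 ⟨n + 1, rfl⟩), hn⟩

theorem exists_le_nsmul_of_wayBelow {k x : S} (h : k ≪ inftyMul x) : ∃ n : ℕ, k ≤ n • x :=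
  h _ (nsmul_mono x) _ (isLUB_inftyMul x) le_rfl

theorem toIdem_le_add {k f : S} {e : idem S} (h : k ≤ f + e.1) : toIdem k ≤ toIdem f + e :=
  toIdem_le.2 (h.trans (add_le_add_left (le_inftyMul f) e.1))

theorem toIdem_two_nsmul (x : S) : toIdem (2 • x) = toIdem x := by
  rw [two_nsmul, toIdem_add]
  exact Subtype.ext (toIdem x).2

theorem exists_wayBelow_le_toIdem {c : idem S} (hc : c ≪ c) {x : S} (h : c ≤ toIdem x) :
    ∃ x', x' ≪ x ∧ c ≤ toIdem x' := by
  obtain ⟨z, hz, hs⟩ := IsCuSemigroup.exists_seq x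
  have hm : Monotone z := monotone_nat_of_le_succ fun n => (hz n).le
  obtain ⟨n, hn⟩ := hc _ (toIdem_mono.comp hm) _ (toIdem_sup hs) h
  exact ⟨z n, (hz n).trans_le (hs.1 ⟨n + 1, rfl⟩), hn⟩

/-- In an algebraic Cu-semigroup, a compact element below a sum is below a sum of compact
elements. -/
theorem IsAlgebraic.exists_compact_le_add (halg : IsAlgebraic S) {c a b : S} (hc : c ≪ c)
    (h : c ≤ a + b) :
    ∃ c₁ c₂, c₁ ≪ c₁ ∧ c₂ ≪ c₂ ∧ c₁ ≤ a ∧ c₂ ≤ b ∧ c ≤ c₁ + c₂ := by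
  obtain ⟨u, hu, huc, hus⟩ := halg a
  obtain ⟨v, hv, hvc, hvs⟩ := halg b
  obtain ⟨n, hn⟩ := hc (fun n => u n + v n) (hu.add hv) _
    (IsCuSemigroup.add_sup u v hu hv a b hus hvs) h
  exact ⟨u n, v n, huc n, hvc n, hus.1 ⟨n, rfl⟩, hvs.1 ⟨n, rfl⟩, hn⟩

end Approximation

/-! ### Lifting, cutting down and merging divisors. -/

section Ideals

variable {S : Type u} [AddCommMonoid S] [PartialOrder S] [IsCuSemigroup S]

theorem O6.exists_le_mod (h6 : O6 S) {k h z : S} {e : idem S} (hk : k ≪ h) (hz : h ≤ z + e.1) :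
    ∃ f, f ≤ h ∧ f ≤ z ∧ k ≤ f + e.1 := by
  obtain ⟨f, g, hf, hfz, _, hge, hkfg⟩ := h6 k h z e.1 hk hz
  exact ⟨f, hf, hfz, hkfg.trans (add_le_add_right hge f)⟩

/-- Divisors modulo an ideal can be lifted. -/
theorem exists_two_nsmul_le_mod (h6 : O6 S) (h8 : O8 S) {k d r : S} {e : idem S}
    (hk : k ≪ d) (hd : 2 • d ≤ r + e.1) : ∃ f, 2 • f ≤ r ∧ k ≤ f + e.1 := by
  obtain ⟨d₁, hk₁, hd₁⟩ := exists_wayBelow_between hk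
  obtain ⟨d₂, h₁₂, hd₂⟩ := exists_wayBelow_between hd₁
  obtain ⟨d₃, h₂₃, hd₃⟩ := exists_wayBelow_between hd₂
  -- (O8) gives two summands, each dominating `d₂` modulo `e`. Cutting first to `z₁` and then to
  -- `z₂` produces one `g` below both, so `g + g ≤ z₁ + z₂ ≤ r`.
  obtain ⟨z₁, z₂, hz, hz₁, hz₂, _, _⟩ := h8 d₂ d₃ d₂ d₃ r e.1 e.2
    ((IsCuSemigroup.add_wayBelow _ _ _ _ hd₃ hd₃).trans_le (two_nsmul d ▸ hd)) h₂₃ h₂₃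
  obtain ⟨f, hf, hfz, hdf⟩ := h6.exists_le_mod h₁₂ hz₁.le
  obtain ⟨f', hf', hkf⟩ := exists_wayBelow_le_add (hk₁.trans_le hdf)
  obtain ⟨g, hgf, hgz, hfg⟩ := h6.exists_le_mod hf' (hf.trans hz₂.le)
  refine ⟨g, ?_, hkf.trans ((add_le_add_left hfg e.1).trans ?_)⟩
  · rw [two_nsmul]
    exact (add_le_add (hgf.trans hfz) hgz).trans hz.le
  · rw [add_assoc, e.2]

/-- Compactness makes the approximation in (O7) lossless on ideals: some `u ≪ y₁` and `v ≪ y₂`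
already generate `c₁` and `c₂`. -/
theorem O7.exists_le_join (h7 : O7 S) {x y₁ y₂ : S} {c₁ c₂ e : idem S} (hc₁ : c₁ ≪ c₁)
    (hc₂ : c₂ ≪ c₂) (h₁ : c₁ ≤ toIdem y₁) (h₂ : c₂ ≤ toIdem y₂) (hx₁ : y₁ ≤ x) (hx₂ : y₂ ≤ x)
    (he₁ : y₁ ≤ e.1) (he₂ : y₂ ≤ e.1) : ∃ z, z ≤ x ∧ z ≤ e.1 ∧ c₁ + c₂ ≤ toIdem z := by
  obtain ⟨u, hu, hcu⟩ := exists_wayBelow_le_toIdem hc₁ h₁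
  obtain ⟨v, hv, hcv⟩ := exists_wayBelow_le_toIdem hc₂ h₂
  obtain ⟨z, huz, hvz, hzx, hz⟩ := h7 u y₁ v y₂ x hu hx₁ hv hx₂
  refine ⟨z, hzx, hz.trans ((add_le_add he₁ he₂).trans e.2.le), ?_⟩
  exact idem_add_le (hcu.trans (toIdem_mono huz.le)) (hcv.trans (toIdem_mono hvz.le))

/-- Induction on `n`: (O6) splits `a` along `n • x + x`, and (O7) rejoins the pieces below a single
`x`, up to the ideal generated. -/
theorem exists_le_of_le_nsmul (h6 : O6 S) (h7 : O7 S) (halg : IsAlgebraic (idem S)) {x : S}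
    {e : idem S} (n : ℕ) {a : S} {c : idem S} (hc : c ≪ c) (hca : c ≤ toIdem a)
    (hax : a ≤ n • x) (hae : a ≤ e.1) : ∃ z, z ≤ x ∧ z ≤ e.1 ∧ c ≤ toIdem z := by
  induction n generalizing a c with
  | zero => exact ⟨a, hax.trans (by simpa using IsCuSemigroup.zero_le' x), hae, hca⟩
  | succ n ih =>
    obtain ⟨a', ha', hca'⟩ := exists_wayBelow_le_toIdem hc hca
    obtain ⟨f, g, hfa, hfx, hga, hgx, hfg⟩ := h6 a' a (n • x) x ha' (succ_nsmul x n ▸ hax)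
    have hcfg : c ≤ toIdem f + toIdem g := by
      rw [← toIdem_add]
      exact hca'.trans (toIdem_mono hfg)
    obtain ⟨c₁, c₂, hc₁, hc₂, hcf, hcg, hcc⟩ := halg.exists_compact_le_add hc hcfg
    obtain ⟨z, hzx, hze, hcz⟩ := ih hc₁ hcf hfx (hfa.trans hae)
    obtain ⟨w, hwx, hwe, hcw⟩ :=
      h7.exists_le_join hc₁ hc₂ hcz hcg hzx hgx hze (hga.trans hae)
    exact ⟨w, hwx, hwe, hcc.trans hcw⟩

/-- An element can be cut down to every compact ideal that it dominates. -/
theorem exists_le_toIdem_eq (h6 : O6 S) (h7 : O7 S) (halg : IsAlgebraic (idem S)) {x : S}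
    {c : idem S} (hc : c ≪ c) (hcx : c ≤ toIdem x) : ∃ z, z ≤ x ∧ toIdem z = c := by
  obtain ⟨a, ha, hca⟩ := exists_wayBelow_le_toIdem hc (toIdem_coe c).ge
  obtain ⟨n, hn⟩ := exists_le_nsmul_of_wayBelow (x := x) (ha.trans_le hcx)
  obtain ⟨z, hzx, hzc, hcz⟩ := exists_le_of_le_nsmul h6 h7 halg n hc hca hn ha.le
  exact ⟨z, hzx, le_antisymm (toIdem_le.2 hzc) hcz⟩

/-- Two divisors that generate compact ideals can be replaced by one. -/
theorem exists_common_divisor (h5 : O5 S) (h6 : O6 S) (h7 : O7 S) (h8 : O8 S)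
    (halg : IsAlgebraic (idem S)) {x d₁ d₂ : S} (hc₁ : toIdem d₁ ≪ toIdem d₁)
    (hc₂ : toIdem d₂ ≪ toIdem d₂) (h₁ : 2 • d₁ ≤ x) (h₂ : 2 • d₂ ≤ x) :
    ∃ d, 2 • d ≤ x ∧ toIdem d₁ + toIdem d₂ ≤ toIdem d := by
  obtain ⟨a, ha, hca⟩ := exists_wayBelow_le_toIdem hc₁ le_rfl
  obtain ⟨a', ha', hca'⟩ := exists_wayBelow_le_toIdem hc₁ hca
  -- `r` is an almost complement of one copy of `d₁`; the other copy ensures `a ≪ r`.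
  obtain ⟨r, har, hrx, hxr⟩ := h5 a d₁ a d₁ x ha ha (two_nsmul d₁ ▸ h₁)
  have hd₂r : 2 • d₂ ≤ r + (toIdem d₁).1 := by
    refine h₂.trans (hxr.trans ?_)
    rw [add_comm]
    exact add_le_add_right (le_inftyMul d₁) r
  obtain ⟨b, hb, hcb⟩ := exists_wayBelow_le_toIdem hc₂ le_rfl
  obtain ⟨f₀, hf₀r, hbf₀⟩ := exists_two_nsmul_le_mod h6 h8 hb hd₂r
  obtain ⟨c, c', hc, _, hcf₀, hc'd₁, hcc'⟩ :=
    halg.exists_compact_le_add hc₂ (hcb.trans (toIdem_le_add hbf₀))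
  -- A compact ideal lets `f` be replaced by some `f' ≪ f`, as (O5) requires, without shrinking the
  -- ideal.
  obtain ⟨f, hff₀, rfl⟩ := exists_le_toIdem_eq h6 h7 halg hc hcf₀
  obtain ⟨f', hf', hcf'⟩ := exists_wayBelow_le_toIdem hc le_rfl
  have hfr : f + f + 0 ≤ r := by
    rw [add_zero]
    exact (add_le_add hff₀ hff₀).trans (two_nsmul f₀ ▸ hf₀r)
  obtain ⟨q, _, hqr, hrq⟩ := h5 (f' + f') (f + f) 0 0 r
    (IsCuSemigroup.add_wayBelow _ _ _ _ hf' hf') (zero_wayBelow 0) hfr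
  -- `g` lies in the ideal of `f`; `h` is the rest of `a'`. It fits below both `a` and `q`, which
  -- makes room for two copies of `f' + h`.
  obtain ⟨g, h, _, hgf, hha, hhq, hgh⟩ := h6 a' a (f + f) q ha' (har.le.trans hrq)
  have hfd : toIdem f ≤ toIdem (f' + h) := hcf'.trans (toIdem_mono (le_add_right' f' h))
  have hd₁ : toIdem d₁ ≤ toIdem (f' + h) := by
    refine hca'.trans ((toIdem_mono hgh).trans ?_)
    rw [toIdem_add g h]
    refine idem_add_le ((toIdem_mono hgf).trans ?_) (toIdem_mono (le_add_left' f' h))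
    rw [← two_nsmul, toIdem_two_nsmul]
    exact hfd
  refine ⟨f' + h, ?_, idem_add_le hd₁ (hcc'.trans (idem_add_le hfd (hc'd₁.trans hd₁)))⟩
  calc 2 • (f' + h) = h + (f' + f' + h) := by rw [two_nsmul]; abel
    _ ≤ a + (f' + f' + q) := add_le_add hha (add_le_add_right hhq _)
    _ ≤ a + r := add_le_add_right hqr a
    _ ≤ x := hrx

theorem exists_divisor_of_le_sum (h5 : O5 S) (h6 : O6 S) (h7 : O7 S) (h8 : O8 S)
    (halg : IsAlgebraic (idem S)) {x : S} (n : ℕ) (d : Fin n → S) (hd : ∀ i, 2 • d i ≤ x)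
    {c : idem S} (hc : c ≪ c) (hcd : c ≤ toIdem (∑ i, d i)) :
    ∃ d, 2 • d ≤ x ∧ c ≤ toIdem d := by
  induction n generalizing c with
  | zero => exact ⟨0, by simpa using IsCuSemigroup.zero_le' x, by simpa using hcd⟩
  | succ n ih =>
    rw [Fin.sum_univ_succ, toIdem_add] at hcd
    obtain ⟨c₁, c₂, hc₁, hc₂, hcd₁, hcd₂, hcc⟩ := halg.exists_compact_le_add hc hcd
    obtain ⟨y, hyx, hcy⟩ := ih (fun i => d i.succ) (fun i => hd i.succ) hc₂ hcd₂
    -- Merging needs divisors with compact ideals, so both are cut down first.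
    obtain ⟨u, hu, rfl⟩ := exists_le_toIdem_eq h6 h7 halg hc₁ hcd₁
    obtain ⟨v, hv, rfl⟩ := exists_le_toIdem_eq h6 h7 halg hc₂ hcy
    obtain ⟨w, hwx, hw⟩ := exists_common_divisor h5 h6 h7 h8 halg hc₁ hc₂
      ((nsmul_le_nsmul_right hu 2).trans (hd 0)) ((nsmul_le_nsmul_right hv 2).trans hyx)
    exact ⟨w, hwx, hcc.trans hw⟩

/-- If `S ⊗ {0,∞}` is algebraic, then so is the semigroup of idempotents of `S`. -/
theorem isAlgebraic_idem {P : Type u} [AddCommMonoid P] [PartialOrder P]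
    {ω : S → zeroInfty → P} (hω : IsCuTensorProduct ω) (halg : IsAlgebraic P) :
    IsAlgebraic (idem S) := by
  intro e
  obtain ⟨α, ⟨hα, hαω⟩, -⟩ := hω.universal (idem S) toIdemPair toIdemPair_bimorphism
  -- `α` sends this tensor to `e`, and Cu-morphisms preserve compactness and suprema.
  obtain ⟨c, hc, hcc, hs⟩ := halg (ω e.1 zeroInfty.infty)
  refine ⟨fun n => α (c n), hα.mono.comp hc, fun n => hα.map_wayBelow _ _ (hcc n), ?_⟩
  have h := hα.map_sup c hc _ hs
  rwa [hαω, toIdemPair_infty, toIdem_coe] at h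

end Ideals

end Cuntz

theorem mainTheorem3 {S : Type u} [AddCommMonoid S] [PartialOrder S] [Cuntz.IsCuSemigroup S]
    (hdiv : Cuntz.WeaklyTwoOmegaDivisible S)
    (h5 : Cuntz.O5 S) (h6 : Cuntz.O6 S) (h7 : Cuntz.O7 S) (h8 : Cuntz.O8 S)
    {P : Type u} [AddCommMonoid P] [PartialOrder P] [Cuntz.IsCuSemigroup P]
    (ω : S → Cuntz.zeroInfty → P) (hω : Cuntz.IsCuTensorProduct ω)
    (halg : Cuntz.IsAlgebraic P) :
    Cuntz.TwoOmegaDivisible S := by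
  have halg' := Cuntz.isAlgebraic_idem hω halg
  intro x' x hx
  obtain ⟨y, hxy, hyx⟩ := Cuntz.exists_wayBelow_between hx
  obtain ⟨u, hu, huc, hus⟩ := halg' (Cuntz.toIdem x)
  -- `u m` is the compact ideal between those of `y` and `x`. As it is compact, some `z ≪ x`
  -- generates an ideal above it, and weak divisibility applies to `z ≪ x`.
  obtain ⟨m, hm⟩ := Cuntz.toIdem_wayBelow hyx u hu _ hus le_rfl
  obtain ⟨z, hzx, hz⟩ := Cuntz.exists_wayBelow_le_toIdem (huc m) (hus.1 ⟨m, rfl⟩)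
  obtain ⟨k, b, hb, hzb⟩ := hdiv z x hzx
  obtain ⟨d, hdx, hd⟩ := Cuntz.exists_divisor_of_le_sum h5 h6 h7 h8 halg' k b hb (huc m)
    (hz.trans (Cuntz.toIdem_mono hzb))
  obtain ⟨n, hn⟩ := Cuntz.exists_le_nsmul_of_wayBelow
    (hxy.trans_le (Cuntz.toIdem_le.1 (hm.trans hd)))
  exact ⟨n, d, hdx, hn⟩
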